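/- Let $(\Omega,\mathcal F,\mathbb P)$ be a probability space on which a random variable uniformly distributed on $\mathbb I=[0,1]$ exists, and let $m\ge 2$ be an integer. For $n\ge 1$ let $L^0(\mathbb I^n)$ be the set of $n$-dimensional random vectors on $\Omega$ with values in $\mathbb I^n$ all of whose coordinates are uniformly distributed on $\mathbb I$. The copula $C_{\vec Z}$ of $\vec Z\in L^0(\mathbb I^k)$ is its joint distribution function. For $k$-dimensional copulas $C,D$ put $[C,D]=\int_{\mathbb I^k}C\,\mathrm dQ^D$, where $Q^D$ is the probability measure on $\mathbb I^k$ with distribution function $D$; let $M(\mathbf u)=\min_i u_i$ and $\Pi(\mathbf u)=\prod_i u_i$. Two uniform random variables are comonotonic if their copula is $M$. Below, $m_1,m_2,m_3$ denote positive integers and $d=(d^{m_1,m_2})_{2\le m_1+m_2\le m}$ a family of maps $d^{m_1,m_2}$ on $L^0(\mathbb I^{m_1})\times L^0(\mathbb I^{m_2})$. It is an *extended dissimilarity function* (of degree $m$) if each $d^{m_1,m_2}$ is an $(m_1,m_2)$-*dissimilarity function*, that is: it has values in $[0,\infty)$; it vanishes at $(\vec X,\vec Y)$ when the copula of $(\vec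 X,\vec Y)$ is $M$; it is invariant under permuting the coordinates of $\vec X$ and those of $\vec Y$; and it depends only on the law of $(\vec X,\vec Y)$; and if moreover $d^{m_1,m_2}(\vec X,\vec Y)=d^{m_2,m_1}(\vec Y,\vec X)$ always. Consider the following properties of $d$ (with $m_1+m_2\le m$ in the first four). * (L1) $d^{m_1,m_2}(\vec X',\vec Y')\le d^{m_1,m_2}(\vec X,\vec Y)$ whenever $\mathbb P((\vec X,\vec Y)\le\mathbf u)\le\mathbb P((\vec X',\vec Y')\le\mathbf u)$ for all $\mathbf u\in\mathbb I^{m_1+m_2}$ (lower orthant order; vector inequalities are coordinatewise). * (L1c) The same conclusion whenever, in addition, $\mathbb P((\vec X,\vec Y)>\mathbf u)\le\mathbb P((\vec X',\vec Y')>\mathbf u)$ for all $\mathbf u$ (concordance order; strict inequality in every coordinate). * (L2) $d^{m_1,m_2}(\vec X,\vec Y)=d^{m_1,m_2}(\mathbf 1-\vec X,\mathbf 1-\vec Y)$. * (L3) If $(\vec X_k,\vec Y_k)$ converges weakly to $(\vec X,\vec Y)$ as $k\to\infty$, then $d^{m_1,m_2}(\vec X_k,\vec Y_k)\to d^{m_1,m_2}(\vec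 X,\vec Y)$. * (G1) For all $m_1+m_2+m_3\le m$ and all $\vec X'\in L^0(\mathbb I^{m_1})$, $\vec X''\in L^0(\mathbb I^{m_2})$, $\vec Y\in L^0(\mathbb I^{m_3})$ whose sets of coordinates are pairwise disjoint sets of random variables (maps on $\Omega$) and which satisfy $d(\vec X',\vec X'')\le\min\{d(\vec X',\vec Y),d(\vec X'',\vec Y)\}$, one has $\min\{d(\vec X',\vec Y),d(\vec X'',\vec Y)\}\le d((\vec X',\vec X''),\vec Y)$. * (G1s) (G1) holds, and the last inequality is strict for at least one $(\vec X',\vec X'',\vec Y)$ as in (G1). * (G2) If $m_1\ge2$, $m_1+m_2\le m$, and a coordinate $X_i$ of $\vec X\in L^0(\mathbb I^{m_1})$ is comonotonic with another coordinate of $\vec X$, then $d^{m_1,m_2}(\vec X,\vec Y)=d^{m_1-1,m_2}(\vec X',\vec Y)$ for all $\vec Y\in L^0(\mathbb I^{m_2})$ and every vector $\vec X'$ consisting of the remaining coordinates of $\vec X$ in any order. **Theorem.** For $m_1+m_2\le m$ and $C=C_{(\vec X,\vec Y)}$ put $$d_\beta(\vec X,\vec Y)=\tfrac12-C(\tfrac12,\dots,\tfrac12),\quad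 d_\phi(\vec X,\vec Y)=\tfrac12-[C,M],\quad d_\tau(\vec X,\vec Y)=\tfrac12-[C,C],\quad d_\rho(\vec X,\vec Y)=\tfrac1{m_1+m_2+1}-[C,\Pi].$$ Then $d_\beta,d_\phi,d_\tau,d_\rho$ are extended dissimilarity functions. Moreover: 1. $d_\beta$ satisfies (L1), (L1c), (L3), (G1), (G2) and, if $m\ge3$, (G1s). 2. $d_\phi$ satisfies (L1), (L1c), (L3), (G1), (G2) and, if $m\ge3$, (G1s). 3. $d_\tau$ satisfies (L1c), (L2), (L3), (G1), (G2) and, if $m\ge3$, (G1s). 4. $d_\rho$ satisfies (L1), (L1c), (L3) and, if $m\ge3$, satisfies none of (G1), (G1s), (G2). -/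

import Mathlib

open MeasureTheory ProbabilityTheory Filter Topology
open scoped unitInterval

noncomputable section

namespace Dissim

/-! ### Copulas -/

/-- A `k`-dimensional copula `C`, given through the probability measure `Q^C` on the cube `I^k`
with uniform one-dimensional margins; the copula itself is the distribution function
`Copula.cdf` of that measure. -/
structure Copula (k : ℕ) where
  /-- The probability measure `Q^C` associated with the copula. -/
  Q : Measure (Fin k → I)
  isProb : IsProbabilityMeasure Q
  margin : ∀ i, Q.map (fun u => u i) = volume

/-- The copula as a function on the cube: `C(u) = Q^C([0, u])`. -/
def Copula.cdf {k : ℕ} (C : Copula k) (u : Fin k → I) : ℝ :=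
  C.Q.real (Set.Iic u)

/-- The comonotonicity copula: the law of `(U, ..., U)` with `U` uniform on `I`. -/
def Copula.M (k : ℕ) : Copula k where
  Q := (volume : Measure I).map (fun u _ => u)
  isProb := Measure.isProbabilityMeasure_map (by fun_prop)
  margin := by
    intro i
    rw [Measure.map_map (by fun_prop) (by fun_prop)]
    exact Measure.map_id

/-- The independence copula: Lebesgue measure on the cube. -/
def Copula.Pi (k : ℕ) : Copula k where
  Q := volume
  isProb := inferInstance
  margin := fun i => (measurePreserving_eval (fun _ : Fin k => (volume : Measure I)) i).map_eq

/-- `M(u) = min {u_1, ..., u_k}`. -/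
theorem Copula.M_cdf {k : ℕ} (u : Fin (k + 1) → I) :
    (Copula.M (k + 1)).cdf u = ((Finset.univ.inf' Finset.univ_nonempty u : I) : ℝ) := by
  have h : (fun (x : I) (_ : Fin (k + 1)) => x) ⁻¹' Set.Iic u
      = Set.Iic (Finset.univ.inf' Finset.univ_nonempty u) := by
    ext x
    simp [Pi.le_def]
  rw [Copula.cdf, Copula.M, measureReal_def, Measure.map_apply (by fun_prop) measurableSet_Iic, h,
    unitInterval.volume_Iic, ENNReal.toReal_ofReal (unitInterval.nonneg _)]

/-- `Π(u) = u_1 ⋯ u_k`. -/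
theorem Copula.Pi_cdf {k : ℕ} (u : Fin k → I) :
    (Copula.Pi k).cdf u = ∏ i, (u i : ℝ) := by
  have h : Set.Iic u = Set.pi Set.univ (fun i => Set.Iic (u i)) := (Set.pi_univ_Iic u).symm
  rw [Copula.cdf, Copula.Pi, measureReal_def, h, volume_pi_pi, ENNReal.toReal_prod]
  refine Finset.prod_congr rfl fun i _ => ?_
  rw [unitInterval.volume_Iic, ENNReal.toReal_ofReal (unitInterval.nonneg _)]

/-- The biconvex form `[C, D] = ∫ C(u) dQ^D(u)`. -/
def bracket {k : ℕ} (C D : Copula k) : ℝ :=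
  ∫ u, C.cdf u ∂D.Q

/-! ### Random vectors with uniform margins -/

variable {Ω : Type*} [MeasurableSpace Ω]

/-- `L⁰(Iⁿ)`: the `n`-dimensional random vectors on the probability space `(Ω, μ)` all of whose
coordinates are uniformly distributed on `I = [0, 1]`. -/
def L0 (μ : Measure Ω) (n : ℕ) : Type _ :=
  {X : Fin n → Ω → I // ∀ i, MeasurePreserving (X i) μ volume}

namespace L0

variable {μ : Measure Ω}

/-- The random vector as a map `Ω → Iⁿ`. -/
def toFun {n : ℕ} (X : L0 μ n) (ω : Ω) : Fin n → I := fun i => X.1 i ω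

theorem measurable_toFun {n : ℕ} (X : L0 μ n) : Measurable X.toFun :=
  measurable_pi_lambda _ fun i => (X.2 i).measurable

/-- The set of random variables that are the coordinates of the random vector. -/
def coords {n : ℕ} (X : L0 μ n) : Set (Ω → I) := Set.range X.1

/-- The concatenation `(X, Y)`. -/
def append {m n : ℕ} (X : L0 μ m) (Y : L0 μ n) : L0 μ (m + n) :=
  ⟨Fin.append X.1 Y.1, fun i => by
    refine Fin.addCases (fun j => ?_) (fun j => ?_) i
    · simpa using X.2 j
    · simpa using Y.2 j⟩

/-- The vector with coordinates selected, in the order given, by `e`. -/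
def select {m n : ℕ} (X : L0 μ m) (e : Fin n → Fin m) : L0 μ n :=
  ⟨fun j => X.1 (e j), fun j => X.2 (e j)⟩

/-- The reflected vector `1 - X`. -/
def reflect {n : ℕ} (X : L0 μ n) : L0 μ n :=
  ⟨fun i ω => σ (X.1 i ω), fun i => unitInterval.measurePreserving_symm.comp (X.2 i)⟩

/-- The copula of a random vector with uniform margins is its joint distribution function. -/
def copula [IsProbabilityMeasure μ] {n : ℕ} (X : L0 μ n) : Copula n where
  Q := μ.map X.toFun
  isProb := Measure.isProbabilityMeasure_map X.measurable_toFun.aemeasurable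
  margin := by
    intro i
    rw [Measure.map_map (by fun_prop) X.measurable_toFun]
    exact (X.2 i).map_eq

variable [IsProbabilityMeasure μ]

/-- The copula of the random vector is the comonotonicity copula `M`. -/
def CopulaEqM {n : ℕ} (X : L0 μ n) : Prop :=
  ∀ u, X.copula.cdf u = (Copula.M n).cdf u

/-- The coordinates `X_i` and `X_j` are comonotonic: the copula of `(X_i, X_j)` is `M`. -/
def ComonotonicAt {n : ℕ} (X : L0 μ n) (i j : Fin n) : Prop :=
  (X.select ![i, j]).CopulaEqM

/-- Lower orthant order `X ⪯ₗₒ Y`: `P(X ≤ u) ≤ P(Y ≤ u)` for all `u`. -/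
def LowerOrthantLE {n : ℕ} (X Y : L0 μ n) : Prop :=
  ∀ u : Fin n → I, μ.real {ω | ∀ i, X.1 i ω ≤ u i} ≤ μ.real {ω | ∀ i, Y.1 i ω ≤ u i}

/-- Concordance order `X ⪯_C Y`: `P(X ≤ u) ≤ P(Y ≤ u)` and `P(X > u) ≤ P(Y > u)` for all `u`. -/
def ConcordanceLE {n : ℕ} (X Y : L0 μ n) : Prop :=
  LowerOrthantLE X Y ∧
    ∀ u : Fin n → I, μ.real {ω | ∀ i, u i < X.1 i ω} ≤ μ.real {ω | ∀ i, u i < Y.1 i ω}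

end L0

/-! ### Dissimilarity functions and their properties -/

/-- A family of maps `d^{m₁,m₂} : L⁰(I^{m₁}) × L⁰(I^{m₂}) → ℝ`. Only the members with
`1 ≤ m₁`, `1 ≤ m₂` and `m₁ + m₂ ≤ m` matter in the notions of degree `m` below. -/
abbrev Family (μ : Measure Ω) : Type _ :=
  ∀ m₁ m₂ : ℕ, L0 μ m₁ → L0 μ m₂ → ℝ

section properties

variable {μ : Measure Ω} [IsProbabilityMeasure μ]

/-- `(m₁, m₂)`-dissimilarity functions. -/
structure IsDissimilarity {m₁ m₂ : ℕ} (d : L0 μ m₁ → L0 μ m₂ → ℝ) : Prop where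
  nonneg : ∀ X Y, 0 ≤ d X Y
  comonotone : ∀ X Y, (X.append Y).CopulaEqM → d X Y = 0
  perm : ∀ X Y (σ₁ : Equiv.Perm (Fin m₁)) (σ₂ : Equiv.Perm (Fin m₂)),
    d X Y = d (X.select σ₁) (Y.select σ₂)
  law : ∀ X Y X₁ Y₁, IdentDistrib (X.append Y).toFun (X₁.append Y₁).toFun μ μ →
    d X Y = d X₁ Y₁

/-- Extended dissimilarity functions of degree `m`. -/
structure IsExtendedDissimilarity (m : ℕ) (d : Family μ) : Prop where
  restrict : ∀ m₁ m₂, 1 ≤ m₁ → 1 ≤ m₂ → m₁ + m₂ ≤ m → IsDissimilarity (d m₁ m₂)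
  symm : ∀ m₁ m₂, 1 ≤ m₁ → 1 ≤ m₂ → m₁ + m₂ ≤ m →
    ∀ (X : L0 μ m₁) (Y : L0 μ m₂), d m₁ m₂ X Y = d m₂ m₁ Y X

/-- Monotonicity with respect to the lower orthant order. -/
def L1 (m : ℕ) (d : Family μ) : Prop :=
  ∀ m₁ m₂, 1 ≤ m₁ → 1 ≤ m₂ → m₁ + m₂ ≤ m →
    ∀ (X X' : L0 μ m₁) (Y Y' : L0 μ m₂), L0.LowerOrthantLE (X.append Y) (X'.append Y') →
      d m₁ m₂ X' Y' ≤ d m₁ m₂ X Y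

/-- Monotonicity with respect to the concordance order. -/
def L1c (m : ℕ) (d : Family μ) : Prop :=
  ∀ m₁ m₂, 1 ≤ m₁ → 1 ≤ m₂ → m₁ + m₂ ≤ m →
    ∀ (X X' : L0 μ m₁) (Y Y' : L0 μ m₂), L0.ConcordanceLE (X.append Y) (X'.append Y') →
      d m₁ m₂ X' Y' ≤ d m₁ m₂ X Y

/-- Rotation invariance. -/
def L2 (m : ℕ) (d : Family μ) : Prop :=
  ∀ m₁ m₂, 1 ≤ m₁ → 1 ≤ m₂ → m₁ + m₂ ≤ m →
    ∀ (X : L0 μ m₁) (Y : L0 μ m₂), d m₁ m₂ X Y = d m₁ m₂ X.reflect Y.reflect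

/-- Continuity with respect to weak convergence. -/
def L3 (m : ℕ) (d : Family μ) : Prop :=
  ∀ m₁ m₂, 1 ≤ m₁ → 1 ≤ m₂ → m₁ + m₂ ≤ m →
    ∀ (Xs : ℕ → L0 μ m₁) (Ys : ℕ → L0 μ m₂) (X : L0 μ m₁) (Y : L0 μ m₂),
      TendstoInDistribution (fun k => ((Xs k).append (Ys k)).toFun) atTop (X.append Y).toFun
        (fun _ => μ) μ →
      Tendsto (fun k => d m₁ m₂ (Xs k) (Ys k)) atTop (𝓝 (d m₁ m₂ X Y))

/-- The triples `(X', X'', Y)` of vectors to which reducibility applies: as sets of random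
variables they are pairwise disjoint, and `X'`, `X''` are the most similar pair. -/
def Reducible (d : Family μ) {m₁ m₂ m₃ : ℕ}
    (X' : L0 μ m₁) (X'' : L0 μ m₂) (Y : L0 μ m₃) : Prop :=
  Disjoint X'.coords X''.coords ∧ Disjoint X'.coords Y.coords ∧ Disjoint X''.coords Y.coords ∧
    d m₁ m₂ X' X'' ≤ min (d m₁ m₃ X' Y) (d m₂ m₃ X'' Y)

/-- Reducibility. -/
def G1 (m : ℕ) (d : Family μ) : Prop :=
  ∀ m₁ m₂ m₃, 1 ≤ m₁ → 1 ≤ m₂ → 1 ≤ m₃ → m₁ + m₂ + m₃ ≤ m →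
    ∀ (X' : L0 μ m₁) (X'' : L0 μ m₂) (Y : L0 μ m₃), Reducible d X' X'' Y →
      min (d m₁ m₃ X' Y) (d m₂ m₃ X'' Y) ≤ d (m₁ + m₂) m₃ (X'.append X'') Y

/-- Strict reducibility: reducibility, with strict inequality for at least one triple. -/
def G1s (m : ℕ) (d : Family μ) : Prop :=
  G1 m d ∧
    ∃ m₁ m₂ m₃, 1 ≤ m₁ ∧ 1 ≤ m₂ ∧ 1 ≤ m₃ ∧ m₁ + m₂ + m₃ ≤ m ∧
      ∃ (X' : L0 μ m₁) (X'' : L0 μ m₂) (Y : L0 μ m₃), Reducible d X' X'' Y ∧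
        min (d m₁ m₃ X' Y) (d m₂ m₃ X'' Y) < d (m₁ + m₂) m₃ (X'.append X'') Y

/-- Comonotonic invariance: if the coordinate `X_i` of `X` is comonotonic with another coordinate
of `X`, then `X_i` may be removed. The vector `X'` lists the remaining coordinates in any order. -/
def G2 (m : ℕ) (d : Family μ) : Prop :=
  ∀ n m₂, 1 ≤ n → 1 ≤ m₂ → (n + 1) + m₂ ≤ m →
    ∀ (X : L0 μ (n + 1)) (Y : L0 μ m₂) (i : Fin (n + 1)) (τ : Equiv.Perm (Fin n)),
      (∃ j, j ≠ i ∧ X.ComonotonicAt i j) →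
      d (n + 1) m₂ X Y = d n m₂ (X.select fun j => i.succAbove (τ j)) Y

/-! ### The four examples -/

/-- The point `1/2` of the unit interval. -/
def half : I := ⟨1 / 2, by norm_num, by norm_num⟩

variable (μ)

/-- Blomqvist's beta: `d_β = 1/2 - C(1/2, ..., 1/2)`. -/
def dBeta : Family μ := fun _ _ X Y => 1 / 2 - (X.append Y).copula.cdf (fun _ => half)

/-- Spearman's footrule: `d_φ = 1/2 - [C, M]`. -/
def dPhi : Family μ := fun _ _ X Y => 1 / 2 - bracket (X.append Y).copula (Copula.M _)

/-- Kendall's tau: `d_τ = 1/2 - [C, C]`. -/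
def dTau : Family μ := fun _ _ X Y => 1 / 2 - bracket (X.append Y).copula (X.append Y).copula

/-- Spearman's rho: `d_ρ = 1/(m₁ + m₂ + 1) - [C, Π]`. -/
def dRho : Family μ := fun m₁ m₂ X Y =>
  1 / ((m₁ : ℝ) + (m₂ : ℝ) + 1) - bracket (X.append Y).copula (Copula.Pi _)

end properties

end Dissim

end

/-!
All four maps have the form `d(X, Y) = c - F(C)`, where `C` is the copula of `(X, Y)`, so everything
is a statement about a functional `F` of copulas.

The form `[C, D]` is the probability that `Z ≤ Z'` for independent `Z ∼ C` and `Z' ∼ D`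
(`bracket_eq_prod`). This makes it monotone in `C` for the lower orthant order
(`bracket_mono_left`), monotone in `D` for the order of survival functions (`bracket_mono_right`),
and jointly weakly continuous (`tendsto_bracket`): weak convergence passes to product measures, and
the boundary of `{z ≤ z'}` is a null set because uniform margins have no atoms.

For beta, the footrule and tau, `F(C)` is the probability of an event of the form "a system of
inequalities holds in every coordinate". Dropping coordinates drops inequalities, so `F` does not
decrease, and it does not change if each dropped coordinate almost surely equals a remaining one
(`IsMarginal`). The first fact gives reducibility, without any use of the assumption that `X'` and
`X''` are the most similar pair; the second gives symmetry, permutation invariance, comonotonic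
invariance and, by reduction to dimension one, `F ≤ 1/2` with equality at `M`. Strict reducibility
holds for three independent uniform variables. They exist because every law on a cube is the image
of the uniform law on `I` (`L0.exists_copula_eq`).

For rho, `[C, Π]` is the expectation of `∏ᵢ (1 - Zᵢ)` (`bracket_Pi_right`). Write `a = 1 - U` and
`b = |1 - 2U|` for a uniform `U`. Since `E[a² b] = 3/16` falls short of `E[a b] = 1/4` by only
`1/16`, less than the difference `1/12` of the constants `1/3` and `1/4`, the vector
`(U, U, 1 - b)` refutes comonotonic invariance. Mixing this law with a little independence makes the
first two coordinates genuinely different and refutes reducibility.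
-/

namespace Dissim

namespace Copula

variable {k n : ℕ}

attribute [instance] Copula.isProb

/-! ### Copulas and their margins -/

theorem ext_Q {C D : Copula k} (h : C.Q = D.Q) : C = D := by
  cases C; cases D; cases h; rfl

/-- A copula measure is determined by its distribution function: the lower orthants form a
π-system that generates the Borel σ-algebra of the cube. -/
theorem ext_cdf {C D : Copula k} (h : ∀ u, C.cdf u = D.cdf u) : C = D := by
  have hspan : IsCountablySpanning (Set.range (Set.Iic : I → Set I)) :=
    ⟨fun _ => Set.Iic ⊤, fun _ => ⟨⊤, rfl⟩, by simp [Set.iUnion_const]⟩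
  have hgen := generateFrom_pi_eq (ι := Fin k) (α := fun _ => I) (fun _ => hspan)
  have hI : (MeasurableSpace.generateFrom (Set.range (Set.Iic : I → Set I)))
      = (inferInstance : MeasurableSpace I) :=
    (borel_eq_generateFrom_Iic I).symm.trans (BorelSpace.measurable_eq (α := I)).symm
  refine ext_Q (ext_of_generate_finite _ (?_ : _ = MeasurableSpace.generateFrom
    (Set.pi Set.univ '' Set.pi Set.univ
      fun _ : Fin k => Set.range (Set.Iic : I → Set I))) ?_ ?_ (by simp))
  · rw [← hgen, hI]
  · exact IsPiSystem.pi fun _ => by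
      rintro _ ⟨a, rfl⟩ _ ⟨b, rfl⟩ -
      exact ⟨a ⊓ b, Set.Iic_inter_Iic.symm⟩
  · rintro _ ⟨s, hs, rfl⟩
    choose u hu using fun i => hs i (Set.mem_univ i)
    obtain rfl : (fun i => Set.Iic (u i)) = s := funext hu
    have := h u
    rw [Set.pi_univ_Iic]
    exact (measureReal_eq_measureReal_iff).1 this

theorem measure_coord (C : Copula k) (i : Fin k) {s : Set I} (hs : MeasurableSet s) :
    C.Q {u | u i ∈ s} = volume s := by
  rw [← C.margin i, Measure.map_apply (by fun_prop) hs]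
  rfl

theorem measure_coord_eq (C : Copula k) (i : Fin k) (a : I) : C.Q {u | u i = a} = 0 :=
  (C.measure_coord i (measurableSet_singleton a)).trans (measure_singleton a)

theorem cdf_le_coord (C : Copula k) (u : Fin k → I) (i : Fin k) : C.cdf u ≤ u i := by
  have h : C.Q.real {v | v i ∈ Set.Iic (u i)} = u i := by
    rw [measureReal_def, C.measure_coord i measurableSet_Iic, unitInterval.volume_Iic,
      ENNReal.toReal_ofReal (unitInterval.nonneg _)]
  rw [← h]
  exact measureReal_mono fun v hv => hv i

/-- The upper Fréchet–Hoeffding bound. -/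
theorem cdf_le_M_cdf (C : Copula k) (u : Fin k → I) : C.cdf u ≤ (M k).cdf u := by
  cases k with
  | zero =>
    have h : Set.Iic u = Set.univ := Set.eq_univ_of_forall fun v => (Subsingleton.elim v u).le
    simp [cdf, h]
  | succ k =>
    obtain ⟨i, -, hi⟩ := Finset.exists_mem_eq_inf' Finset.univ_nonempty u
    rw [M_cdf, hi]
    exact C.cdf_le_coord u i

theorem eq_M_one (C : Copula 1) : C = M 1 := by
  refine ext_cdf fun u => le_antisymm (C.cdf_le_M_cdf u) ?_
  have h : C.Q.real {v | v 0 ∈ Set.Iic (u 0)} = u 0 := by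
    rw [measureReal_def, C.measure_coord 0 measurableSet_Iic, unitInterval.volume_Iic,
      ENNReal.toReal_ofReal (unitInterval.nonneg _)]
  have h' : {v : Fin 1 → I | v 0 ∈ Set.Iic (u 0)} = Set.Iic u := by
    ext v
    simp [Pi.le_def]
  refine le_of_le_of_eq ?_ (h.symm.trans (by rw [cdf, h']))
  exact (M 1).cdf_le_coord u 0

/-- The copula of the vector obtained by selecting coordinates, possibly with repetitions. -/
noncomputable def select (C : Copula k) (e : Fin n → Fin k) : Copula n where
  Q := C.Q.map (fun u j => u (e j))
  isProb := Measure.isProbabilityMeasure_map (Measurable.aemeasurable (by fun_prop))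
  margin := by
    intro j
    rw [Measure.map_map (by fun_prop) (by fun_prop)]
    exact C.margin (e j)

theorem select_cdf (C : Copula k) (e : Fin n → Fin k) (u : Fin n → I) :
    (C.select e).cdf u = C.Q.real {v | ∀ j, v (e j) ≤ u j} := by
  rw [cdf, select, map_measureReal_apply (by fun_prop) measurableSet_Iic]
  rfl

theorem M_select (e : Fin n → Fin k) : (M k).select e = M n := by
  refine ext_Q ?_
  change Measure.map _ (Measure.map _ _) = Measure.map _ _
  rw [Measure.map_map (by fun_prop) (by fun_prop)]
  rfl

theorem M_ae_eq (i j : Fin k) : ∀ᵐ u ∂(M k).Q, u i = u j := by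
  rw [M, ae_map_iff (by fun_prop) (measurableSet_eq_fun (by fun_prop) (by fun_prop))]
  simp

/-- Distinct coordinates of an independent vector are again independent. -/
theorem Pi_select {e : Fin n → Fin k} (he : Function.Injective e) : (Pi k).select e = Pi n := by
  refine ext_cdf fun u => ?_
  have hset : {v : Fin k → I | ∀ j, v (e j) ≤ u j} = Set.Iic (Function.extend e u 1) := by
    ext v
    refine ⟨fun h i => ?_, fun h j => ?_⟩
    · by_cases hi : ∃ j, e j = i
      · obtain ⟨j, rfl⟩ := hi
        simpa [he.extend_apply] using h j
      · simpa [Function.extend_apply' _ _ _ hi] using unitInterval.le_one'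
    · simpa [he.extend_apply] using h (e j)
  rw [select_cdf, hset, ← cdf, Pi_cdf, Pi_cdf]
  refine (Fintype.prod_of_injective e he _ _ (fun i hi => ?_) fun j => ?_).symm
  · rw [Function.extend_apply' _ _ _ hi]
    rfl
  · rw [he.extend_apply]

end Copula

/-! ### The biconvex form -/

section Bracket

variable {k n : ℕ}

theorem bracket_eq_lintegral (C D : Copula k) :
    bracket C D = (∫⁻ u, C.Q (Set.Iic u) ∂D.Q).toReal := by
  have hS : MeasurableSet {p : (Fin k → I) × (Fin k → I) | p.1 ≤ p.2} := measurableSet_le'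
  have hm : Measurable fun u => C.Q (Set.Iic u) := measurable_measure_prodMk_right hS
  exact integral_toReal hm.aemeasurable (ae_of_all _ fun _ => measure_lt_top _ _)

/-- `[C, D]` is the probability that `Z ≤ Z'` for independent `Z ∼ C`, `Z' ∼ D`. -/
theorem bracket_eq_prod (C D : Copula k) :
    bracket C D = (C.Q.prod D.Q).real {p | p.1 ≤ p.2} := by
  rw [bracket_eq_lintegral, measureReal_def, Measure.prod_apply_symm measurableSet_le']
  rfl

theorem bracket_eq_lintegral_Ici (C D : Copula k) :
    bracket C D = (∫⁻ u, D.Q (Set.Ici u) ∂C.Q).toReal := by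
  rw [bracket_eq_prod, measureReal_def, Measure.prod_apply measurableSet_le']
  rfl

theorem bracket_eq_integral_Ici (C D : Copula k) :
    bracket C D = ∫ u, D.Q.real (Set.Ici u) ∂C.Q := by
  have hS : MeasurableSet {p : (Fin k → I) × (Fin k → I) | p.1 ≤ p.2} := measurableSet_le'
  have hm : Measurable fun u => D.Q (Set.Ici u) := measurable_measure_prodMk_left hS
  rw [bracket_eq_lintegral_Ici]
  exact (integral_toReal hm.aemeasurable (ae_of_all _ fun _ => measure_lt_top _ _)).symm

theorem bracket_mono_left {C C' : Copula k} (D : Copula k) (h : ∀ u, C.cdf u ≤ C'.cdf u) :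
    bracket C D ≤ bracket C' D := by
  rw [bracket_eq_lintegral, bracket_eq_lintegral]
  refine ENNReal.toReal_mono ?_ (lintegral_mono fun u => ?_)
  · refine ((lintegral_mono fun _ => prob_le_one).trans_lt ?_).ne
    simp
  · exact (ENNReal.toReal_le_toReal (measure_ne_top _ _) (measure_ne_top _ _)).1 (h u)

/-- The closed and the open upper orthant have the same mass as the margins have no atoms. -/
theorem Copula.measure_Ici (C : Copula k) (u : Fin k → I) :
    C.Q (Set.Ici u) = C.Q {v | ∀ i, u i < v i} := by
  refine le_antisymm ?_ (measure_mono fun v hv i => (hv i).le)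
  have h : Set.Ici u ⊆ {v | ∀ i, u i < v i} ∪ ⋃ i, {v | v i = u i} := by
    intro v hv
    by_cases hc : ∃ i, v i = u i
    · exact Or.inr (Set.mem_iUnion.2 hc)
    · push Not at hc
      exact Or.inl fun i => lt_of_le_of_ne (hv i) (hc i).symm
  refine (measure_mono h).trans ((measure_union_le _ _).trans ?_)
  rw [measure_iUnion_null fun i => C.measure_coord_eq i (u i), add_zero]

/-- `[C, D]` is monotone in `D` with respect to survival functions. -/
theorem bracket_mono_right (C : Copula k) {D D' : Copula k}
    (h : ∀ u : Fin k → I, D.Q.real {v | ∀ i, u i < v i} ≤ D'.Q.real {v | ∀ i, u i < v i}) :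
    bracket C D ≤ bracket C D' := by
  rw [bracket_eq_lintegral_Ici, bracket_eq_lintegral_Ici]
  refine ENNReal.toReal_mono ?_ (lintegral_mono fun u => ?_)
  · refine ((lintegral_mono fun _ => prob_le_one).trans_lt ?_).ne
    simp
  · simp only [Copula.measure_Ici]
    exact (ENNReal.toReal_le_toReal (measure_ne_top _ _) (measure_ne_top _ _)).1 (h u)

theorem bracket_select (C D : Copula k) (e : Fin n → Fin k) :
    bracket (C.select e) (D.select e)
      = (C.Q.prod D.Q).real {p | ∀ j, p.1 (e j) ≤ p.2 (e j)} := by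
  rw [bracket_eq_prod, Copula.select, Copula.select]
  dsimp only
  rw [Measure.map_prod_map _ _ (by fun_prop) (by fun_prop),
    map_measureReal_apply (by fun_prop) measurableSet_le']
  rfl

theorem bracket_le_bracket_select (C D : Copula k) (e : Fin n → Fin k) :
    bracket C D ≤ bracket (C.select e) (D.select e) := by
  rw [bracket_select, bracket_eq_prod]
  exact measureReal_mono fun p hp j => hp (e j)

theorem bracket_select_eq (C D : Copula k) (e : Fin n → Fin k)
    (hC : ∀ i, ∃ j, ∀ᵐ u ∂C.Q, u i = u (e j)) (hD : ∀ i j, (∀ᵐ u ∂C.Q, u i = u (e j)) →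
      ∀ᵐ u ∂D.Q, u i = u (e j)) :
    bracket (C.select e) (D.select e) = bracket C D := by
  refine le_antisymm ?_ (bracket_le_bracket_select C D e)
  choose r hr using hC
  rw [bracket_select, bracket_eq_prod]
  refine ENNReal.toReal_mono (measure_ne_top _ _) (measure_mono_ae ?_)
  have h1 : ∀ᵐ p ∂C.Q.prod D.Q, ∀ i, p.1 i = p.1 (e (r i)) :=
    Measure.quasiMeasurePreserving_fst.ae (ae_all_iff.2 hr)
  have h2 : ∀ᵐ p ∂C.Q.prod D.Q, ∀ i, p.2 i = p.2 (e (r i)) :=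
    Measure.quasiMeasurePreserving_snd.ae (ae_all_iff.2 fun i => hD i _ (hr i))
  filter_upwards [h1, h2] with p hp1 hp2 hp i
  rw [hp1 i, hp2 i]
  exact hp (r i)

theorem integral_unitInterval_eq (f : ℝ → ℝ) :
    ∫ x : I, f x = ∫ x in (0 : ℝ)..1, f x := by
  rw [intervalIntegral.integral_of_le zero_le_one, ← integral_Icc_eq_integral_Ioc]
  exact (unitInterval.measurePreserving_coe.integral_comp
    unitInterval.measurableEmbedding_coe f)

theorem bracket_M_right (C : Copula k) : bracket C (Copula.M k) = ∫ x : I, C.cdf fun _ => x := by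
  have hS : MeasurableSet {p : (Fin k → I) × (Fin k → I) | p.1 ≤ p.2} := measurableSet_le'
  have hm : Measurable fun u => C.Q (Set.Iic u) := measurable_measure_prodMk_right hS
  rw [bracket, Copula.M, integral_map (by fun_prop)]
  exact hm.ennreal_toReal.aestronglyMeasurable

theorem bracket_M_one : bracket (Copula.M 1) (Copula.M 1) = 1 / 2 := by
  rw [bracket_M_right]
  have h (x : I) : ((Copula.M 1).cdf fun _ => x) = x := by
    simp [Copula.M_cdf (k := 0)]
  simp_rw [h]
  rw [integral_unitInterval_eq fun x => x]
  simp

/-- `[C, Π]` is the expectation of `∏ᵢ (1 - Zᵢ)` for `Z ∼ C`. -/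
theorem bracket_Pi_right (C : Copula k) :
    bracket C (Copula.Pi k) = ∫ u, ∏ i, (1 - (u i : ℝ)) ∂C.Q := by
  rw [bracket_eq_integral_Ici]
  refine integral_congr_ae (ae_of_all _ fun u => ?_)
  have h : Set.Ici u = Set.pi Set.univ fun i => Set.Ici (u i) := (Set.pi_univ_Ici u).symm
  simp only [Copula.Pi, measureReal_def, h]
  rw [volume_pi_pi, ENNReal.toReal_prod]
  refine Finset.prod_congr rfl fun i _ => ?_
  rw [unitInterval.volume_Ici, ENNReal.toReal_ofReal (unitInterval.one_minus_nonneg _)]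

theorem bracket_Pi_Pi : bracket (Copula.Pi k) (Copula.Pi k) = (1 / 2) ^ k := by
  rw [bracket_Pi_right, Copula.Pi]
  refine (integral_fintype_prod_volume_eq_pow (ι := Fin k) (fun x : I => 1 - (x : ℝ))).trans ?_
  rw [integral_unitInterval_eq fun x => 1 - x, Fintype.card_fin,
    intervalIntegral.integral_comp_sub_left fun x => x]
  norm_num [integral_id]

theorem bracket_M_Pi : bracket (Copula.M k) (Copula.Pi k) = 1 / ((k : ℝ) + 1) := by
  rw [bracket_Pi_right, Copula.M, integral_map (by fun_prop)
    (Measurable.aestronglyMeasurable (by fun_prop))]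
  simp only [Finset.prod_const, Finset.card_univ, Fintype.card_fin]
  rw [integral_unitInterval_eq fun x => (1 - x) ^ k]
  rw [intervalIntegral.integral_comp_sub_left (fun x => x ^ k)]
  simp

theorem bracket_Pi_M : bracket (Copula.Pi k) (Copula.M k) = 1 / ((k : ℝ) + 1) := by
  rw [bracket_M_right]
  simp only [Copula.Pi_cdf, Finset.prod_const, Finset.card_univ, Fintype.card_fin]
  rw [integral_unitInterval_eq fun x => x ^ k]
  simp

end Bracket

/-! ### Weak convergence -/

section Weak

variable {k : ℕ}

/-- The measure of a copula as a point of the space of probability measures with the topology of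
weak convergence. -/
def Copula.law (C : Copula k) : ProbabilityMeasure (Fin k → I) := ⟨C.Q, C.isProb⟩

theorem tendsto_cdf {Cs : ℕ → Copula k} {C : Copula k}
    (h : Tendsto (fun n => (Cs n).law) atTop (𝓝 C.law)) (u : Fin k → I) :
    Tendsto (fun n => (Cs n).cdf u) atTop (𝓝 (C.cdf u)) := by
  have hnull : C.Q (frontier (Set.Iic u)) = 0 := by
    refine measure_mono_null (t := ⋃ i, {v : Fin k → I | v i = u i}) (fun (v : Fin k → I) hv => ?_)
      (measure_iUnion_null fun i => C.measure_coord_eq i (u i))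
    have hopen : IsOpen {v : Fin k → I | ∀ i, v i < u i} := by
      simp only [Set.ofPred_forall]
      exact isOpen_iInter_of_finite fun i => isOpen_lt (by fun_prop) (by fun_prop)
    have hle : v ≤ u := isClosed_Iic.frontier_subset hv
    by_contra hc
    simp only [Set.mem_iUnion, Set.mem_ofPred_eq, not_exists] at hc
    exact hv.2 (mem_interior.2 ⟨_, fun w hw i => (hw i).le, hopen,
      fun i => lt_of_le_of_ne (hle i) (hc i)⟩)
  exact (ENNReal.continuousAt_toReal (measure_ne_top _ _)).tendsto.comp
    (ProbabilityMeasure.tendsto_measure_of_null_frontier_of_tendsto' h hnull)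

/-- The form `[C, D]` is jointly weakly continuous: products of weakly convergent measures
converge weakly, and the boundary of `{(z, z') | z ≤ z'}` is null as the margins have no atoms. -/
theorem tendsto_bracket {Cs Ds : ℕ → Copula k} {C D : Copula k}
    (hC : Tendsto (fun n => (Cs n).law) atTop (𝓝 C.law))
    (hD : Tendsto (fun n => (Ds n).law) atTop (𝓝 D.law)) :
    Tendsto (fun n => bracket (Cs n) (Ds n)) atTop (𝓝 (bracket C D)) := by
  simp only [bracket_eq_prod]
  have hprod : Tendsto (fun n => (Cs n).law.prod (Ds n).law) atTop (𝓝 (C.law.prod D.law)) :=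
    (ProbabilityMeasure.continuous_prod.tendsto (C.law, D.law)).comp (hC.prodMk_nhds hD)
  have hzero (i : Fin k) :
      (C.Q.prod D.Q) {p : (Fin k → I) × (Fin k → I) | p.1 i = p.2 i} = 0 := by
    rw [Measure.prod_apply_symm (measurableSet_eq_fun (by fun_prop) (by fun_prop))]
    exact (lintegral_congr fun v : Fin k → I => C.measure_coord_eq i (v i)).trans lintegral_zero
  have hnull : (C.Q.prod D.Q)
      (frontier {p : (Fin k → I) × (Fin k → I) | p.1 ≤ p.2}) = 0 := by
    refine measure_mono_null (fun p hp => ?_) (measure_iUnion_null hzero)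
    have hopen : IsOpen {p : (Fin k → I) × (Fin k → I) | ∀ i, p.1 i < p.2 i} := by
      simp only [Set.ofPred_forall]
      exact isOpen_iInter_of_finite fun i => isOpen_lt (by fun_prop) (by fun_prop)
    have hle : p.1 ≤ p.2 := (isClosed_le continuous_fst continuous_snd).frontier_subset hp
    by_contra hc
    simp only [Set.mem_iUnion, Set.mem_ofPred_eq, not_exists] at hc
    exact hp.2 (mem_interior.2 ⟨_, fun w hw i => (hw i).le, hopen,
      fun i => lt_of_le_of_ne (hle i) (hc i)⟩)
  exact (ENNReal.continuousAt_toReal (measure_ne_top _ _)).tendsto.comp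
    (ProbabilityMeasure.tendsto_measure_of_null_frontier_of_tendsto' hprod hnull)

end Weak

/-! ### Random vectors and their copulas -/

namespace L0

variable {Ω : Type*} [MeasurableSpace Ω] {μ : Measure Ω} {k n m₁ m₂ : ℕ}

theorem append_select (X : L0 μ m₁) (Y : L0 μ m₂) (e : Fin k → Fin m₁) (f : Fin n → Fin m₂) :
    (X.select e).append (Y.select f) = (X.append Y).select
      (Fin.append (fun i => Fin.castAdd m₂ (e i)) fun j => Fin.natAdd m₁ (f j)) := by
  refine Subtype.ext (funext fun i => ?_)
  refine Fin.addCases (fun i => ?_) (fun j => ?_) i <;> simp [append, select]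

theorem append_comm (X : L0 μ m₁) (Y : L0 μ m₂) :
    Y.append X = (X.append Y).select (finAddFlip : Fin (m₂ + m₁) ≃ Fin (m₁ + m₂)) := by
  refine Subtype.ext (funext fun i => ?_)
  refine Fin.addCases (fun i => ?_) (fun j => ?_) i <;> simp [append, select]

theorem append_eq_select_append (X : L0 μ k) (X' : L0 μ n) (Y : L0 μ m₁) :
    X.append Y = ((X.append X').append Y).select
      (Fin.append (fun i => Fin.castAdd m₁ (Fin.castAdd n i)) fun j => Fin.natAdd (k + n) j) := by
  refine Subtype.ext (funext fun i => ?_)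
  refine Fin.addCases (fun i => ?_) (fun j => ?_) i <;> simp [append, select]

variable [IsProbabilityMeasure μ]

theorem copula_Q (X : L0 μ k) : X.copula.Q = μ.map X.toFun := rfl

theorem select_copula (X : L0 μ k) (e : Fin n → Fin k) :
    (X.select e).copula = X.copula.select e := by
  refine Copula.ext_Q ?_
  change _ = Measure.map _ (Measure.map _ _)
  rw [Measure.map_map (by fun_prop) X.measurable_toFun]
  rfl

theorem copula_cdf (X : L0 μ k) (u : Fin k → I) :
    X.copula.cdf u = μ.real {ω | ∀ i, X.1 i ω ≤ u i} := by
  rw [Copula.cdf, copula_Q, map_measureReal_apply X.measurable_toFun measurableSet_Iic]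
  rfl

theorem copula_survival (X : L0 μ k) (u : Fin k → I) :
    X.copula.Q.real {v | ∀ i, u i < v i} = μ.real {ω | ∀ i, u i < X.1 i ω} := by
  rw [copula_Q, map_measureReal_apply X.measurable_toFun]
  · rfl
  · simp only [Set.ofPred_forall]
    exact MeasurableSet.iInter fun i => measurableSet_lt (by fun_prop) (by fun_prop)

theorem CopulaEqM.copula_eq {X : L0 μ k} (h : X.CopulaEqM) : X.copula = Copula.M k :=
  Copula.ext_cdf h

theorem ae_copula_iff (X : L0 μ k) (i j : Fin k) :
    (∀ᵐ u ∂X.copula.Q, u i = u j) ↔ ∀ᵐ ω ∂μ, X.1 i ω = X.1 j ω := by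
  rw [copula_Q, ae_map_iff X.measurable_toFun.aemeasurable
    (measurableSet_eq_fun (by fun_prop) (by fun_prop))]
  rfl

theorem ComonotonicAt.ae_eq {X : L0 μ k} {i j : Fin k} (h : X.ComonotonicAt i j) :
    ∀ᵐ ω ∂μ, X.1 i ω = X.1 j ω := by
  have h' := Copula.M_ae_eq (0 : Fin 2) 1
  rw [← h.copula_eq, ae_copula_iff] at h'
  exact h'

/-- Every copula is the copula of a random vector as soon as the probability space carries one
uniform random variable. -/
theorem exists_copula_eq (hU : ∃ U : Ω → I, MeasurePreserving U μ volume) (C : Copula k) :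
    ∃ X : L0 μ k, X.copula = C := by
  obtain ⟨U, hU⟩ := hU
  obtain ⟨f, hf, hfC⟩ := C.Q.exists_measurable_map_eq
  have hm (i : Fin k) : MeasurePreserving (fun u : Fin k → I => u i) (volume.map f) volume :=
    ⟨by fun_prop, by rw [hfC]; exact C.margin i⟩
  refine ⟨⟨fun i ω => f (U ω) i, fun i => (hm i).comp ((hf.measurePreserving _).comp hU)⟩,
    Copula.ext_Q ?_⟩
  rw [← hfC]
  exact ((hf.measurePreserving _).comp hU).map_eq

/-- A three-dimensional copula is realized by a triple of uniform random variables. -/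
theorem exists_triple (hU : ∃ U : Ω → I, MeasurePreserving U μ volume) (C : Copula 3) :
    ∃ X' X'' Y : L0 μ 1, (X'.append X'').copula = C.select ![0, 1] ∧
      (X'.append Y).copula = C.select ![0, 2] ∧ (X''.append Y).copula = C.select ![1, 2] ∧
      ((X'.append X'').append Y).copula = C := by
  obtain ⟨X, rfl⟩ := exists_copula_eq hU C
  refine ⟨X.select ![0], X.select ![1], X.select ![2], ?_, ?_, ?_, ?_⟩
  · rw [← select_copula]
    congr 1
    refine Subtype.ext (funext fun i => ?_)
    fin_cases i <;> rfl
  · rw [← select_copula]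
    congr 1
    refine Subtype.ext (funext fun i => ?_)
    fin_cases i <;> rfl
  · rw [← select_copula]
    congr 1
    refine Subtype.ext (funext fun i => ?_)
    fin_cases i <;> rfl
  · congr 1
    refine Subtype.ext (funext fun i => ?_)
    fin_cases i <;> rfl

theorem disjoint_coords_of_copula_ne {X Y : L0 μ 1} (h : (X.append Y).copula ≠ Copula.M 2) :
    Disjoint X.coords Y.coords := by
  rw [Set.disjoint_left]
  rintro _ ⟨i, rfl⟩ ⟨j, hj⟩
  refine h (Copula.ext_Q ?_)
  have hXY : (X.append Y).toFun = (fun (x : I) (_ : Fin 2) => x) ∘ X.1 i := by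
    funext ω l
    obtain rfl := Subsingleton.elim i 0
    obtain rfl := Subsingleton.elim j 0
    fin_cases l
    · rfl
    · exact congrFun hj ω
  rw [copula_Q, hXY, ← Measure.map_map (by fun_prop) (X.2 i).measurable, (X.2 i).map_eq]
  rfl

end L0

/-! ### Families of maps given by functionals of copulas -/

section Family

variable {Ω : Type*} [MeasurableSpace Ω] {μ : Measure Ω}

theorem L1.toL1c {m : ℕ} {d : Family μ} (h : L1 m d) : L1c m d :=
  fun m₁ m₂ h₁ h₂ hm X X' Y Y' hXY => h m₁ m₂ h₁ h₂ hm X X' Y Y' hXY.1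

variable [IsProbabilityMeasure μ] {c : ℕ → ℝ} {F : ∀ k, Copula k → ℝ}

/-- The family `d(X, Y) = c - F(C)` given by a functional `F` of the copula `C` of `(X, Y)`, the
constant `c` depending on the dimension of `C`. -/
noncomputable def family (μ : Measure Ω) [IsProbabilityMeasure μ] (c : ℕ → ℝ)
    (F : ∀ k, Copula k → ℝ) : Family μ :=
  fun m₁ m₂ X Y => c (m₁ + m₂) - F (m₁ + m₂) (X.append Y).copula

/-- A functional invariant under permutations and maximal at `M` defines an extended dissimilarity
function. -/
theorem isExtendedDissimilarity_family (m : ℕ)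
    (hle : ∀ k (C : Copula (k + 1)), F (k + 1) C ≤ c (k + 1))
    (hM : ∀ k, F (k + 1) (Copula.M (k + 1)) = c (k + 1))
    (hsel : ∀ k n (C : Copula k) (e : Fin n ≃ Fin k), F n (C.select e) = F k C) :
    IsExtendedDissimilarity m (family μ c F) where
  restrict m₁ m₂ h₁ h₂ _ := by
    obtain ⟨k, rfl⟩ := Nat.exists_eq_add_of_le' h₂
    refine ⟨fun X Y => sub_nonneg.2 (hle _ _), fun X Y h => ?_, fun X Y σ₁ σ₂ => ?_,
      fun X Y X₁ Y₁ h => ?_⟩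
    · rw [family, h.copula_eq]
      exact sub_eq_zero.2 (hM _).symm
    · have he : (Fin.append (fun i => Fin.castAdd (k + 1) (σ₁ i)) fun j => Fin.natAdd m₁ (σ₂ j))
          = finSumFinEquiv.symm.trans ((Equiv.sumCongr σ₁ σ₂).trans finSumFinEquiv) := by
        funext i
        refine Fin.addCases (fun i => ?_) (fun j => ?_) i <;> simp
      rw [family, family, L0.append_select, L0.select_copula, he, hsel]
    · have : (X.append Y).copula = (X₁.append Y₁).copula := Copula.ext_Q h.map_eq
      rw [family, family, this]
  symm m₁ m₂ _ _ _ X Y := by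
    rw [family, family, L0.append_comm X Y, L0.select_copula, hsel]
    exact congrArg (c · - _) (Nat.add_comm m₁ m₂)

theorem L1_family (m : ℕ)
    (hF : ∀ k (C D : Copula k), (∀ u, C.cdf u ≤ D.cdf u) → F k C ≤ F k D) :
    L1 m (family μ c F) := by
  intro m₁ m₂ _ _ _ X X' Y Y' h
  refine sub_le_sub_left (hF _ _ _ fun u => ?_) _
  rw [L0.copula_cdf, L0.copula_cdf]
  exact h u

theorem L3_family (m : ℕ)
    (hF : ∀ k (Cs : ℕ → Copula k) (C : Copula k),
      Tendsto (fun n => (Cs n).law) atTop (𝓝 C.law) →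
        Tendsto (fun n => F k (Cs n)) atTop (𝓝 (F k C))) :
    L3 m (family μ c F) :=
  fun _ _ _ _ _ Xs Ys X Y h =>
    (hF _ (fun n => ((Xs n).append (Ys n)).copula) (X.append Y).copula h.tendsto).const_sub _

/-- The properties of a functional of copulas behind reducibility and comonotonic invariance:
passing to a margin does not decrease the functional, and does not change it if every coordinate
left out almost surely equals a selected one. The normalization in dimension one fixes the maximum
`1/2` in every dimension. -/
structure IsMarginal (F : ∀ k, Copula k → ℝ) : Prop where
  le_select : ∀ k n (C : Copula k) (e : Fin n → Fin k), F k C ≤ F n (C.select e)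
  select_eq : ∀ k n (C : Copula k) (e : Fin n → Fin k),
    (∀ i, ∃ j, ∀ᵐ u ∂C.Q, u i = u (e j)) → F n (C.select e) = F k C
  one : F 1 (Copula.M 1) = 1 / 2

theorem IsMarginal.isExtendedDissimilarity (hF : IsMarginal F) (m : ℕ) :
    IsExtendedDissimilarity m (family μ (fun _ => 1 / 2) F) := by
  refine isExtendedDissimilarity_family m (fun k C => ?_) (fun k => ?_) fun k n C e => ?_
  · refine (hF.le_select _ 1 C fun _ => 0).trans_eq ?_
    rw [Copula.eq_M_one (C.select _), hF.one]
  · rw [← hF.select_eq _ 1 (Copula.M (k + 1)) (fun _ => 0) fun i => ⟨0, Copula.M_ae_eq _ _⟩,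
      Copula.M_select, hF.one]
  · exact hF.select_eq _ _ C e fun i => ⟨e.symm i, by simp⟩

theorem IsMarginal.G1 (hF : IsMarginal F) (m : ℕ) : G1 m (family μ (fun _ => 1 / 2) F) := by
  intro m₁ m₂ m₃ _ _ _ _ X' X'' Y _
  refine (min_le_left _ _).trans (sub_le_sub_left ?_ _)
  rw [L0.append_eq_select_append X' X'' Y, L0.select_copula]
  exact hF.le_select _ _ _ _

theorem IsMarginal.G2 (hF : IsMarginal F) (m : ℕ) : G2 m (family μ (fun _ => 1 / 2) F) := by
  rintro n m₂ _ _ _ X Y i τ ⟨j, hji, hj⟩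
  refine congrArg (1 / 2 - ·) ?_
  have hY : (X.select fun j => i.succAbove (τ j)).append Y = _ :=
    L0.append_select X Y (fun j => i.succAbove (τ j)) id
  rw [hY, L0.select_copula]
  refine (hF.select_eq _ _ _ _ fun l => ?_).symm
  have hne (l : Fin (n + 1)) (hl : l ≠ i) : ∃ a, i.succAbove (τ a) = l := by
    obtain ⟨a, ha⟩ := Fin.exists_succAbove_eq hl
    exact ⟨τ.symm a, by simpa using ha⟩
  refine Fin.addCases (fun l => ?_) (fun l => ?_) l
  · by_cases hl : l = i
    -- The removed coordinate equals the remaining coordinate `j` almost surely.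
    · obtain ⟨a, ha⟩ := hne j hji
      refine ⟨Fin.castAdd m₂ a, ?_⟩
      rw [L0.ae_copula_iff]
      filter_upwards [hj.ae_eq] with ω hω
      simpa [L0.append, ha, hl] using hω
    · obtain ⟨a, ha⟩ := hne l hl
      exact ⟨Fin.castAdd m₂ a, by simp [ha]⟩
  · exact ⟨Fin.natAdd n l, by simp⟩

/-- Three independent coordinates have the same pairwise dissimilarities, so that they are
reducible, and they witness strictness. -/
theorem IsMarginal.G1s (hF : IsMarginal F) (hU : ∃ U : Ω → I, MeasurePreserving U μ volume)
    (h3 : F 3 (Copula.Pi 3) < F 2 (Copula.Pi 2)) (h2 : F 2 (Copula.Pi 2) < 1 / 2)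
    {m : ℕ} (hm : 3 ≤ m) : G1s m (family μ (fun _ => 1 / 2) F) := by
  refine ⟨hF.G1 m, 1, 1, 1, le_rfl, le_rfl, le_rfl, hm, ?_⟩
  obtain ⟨X', X'', Y, h01, h02, h12, h012⟩ := L0.exists_triple hU (Copula.Pi 3)
  rw [Copula.Pi_select (by decide)] at h01 h02 h12
  -- Variables that coincide as maps have copula `M`, where `F` takes the value `1/2`.
  have hne : Copula.Pi 2 ≠ Copula.M 2 := by
    intro h
    have hM := hF.select_eq 2 1 (Copula.M 2) (fun _ => 0) fun i => ⟨0, Copula.M_ae_eq _ _⟩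
    rw [Copula.M_select, hF.one, ← h] at hM
    exact h2.ne hM.symm
  refine ⟨X', X'', Y, ⟨L0.disjoint_coords_of_copula_ne (h01.trans_ne hne),
    L0.disjoint_coords_of_copula_ne (h02.trans_ne hne),
    L0.disjoint_coords_of_copula_ne (h12.trans_ne hne), ?_⟩, ?_⟩
  · simp only [family, h01, h02, h12]
    exact (min_self _).ge
  · simp only [family, h02, h12, h012, min_self]
    exact sub_lt_sub_left h3 _

end Family

/-! ### Blomqvist's beta, Spearman's footrule and Kendall's tau -/

theorem isMarginal_beta : IsMarginal fun _ C => C.cdf fun _ => half where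
  le_select k n C e := by
    rw [Copula.select_cdf]
    exact measureReal_mono fun u hu j => hu (e j)
  select_eq k n C e h := by
    choose r hr using h
    rw [Copula.select_cdf]
    refine measureReal_congr ?_
    filter_upwards [ae_all_iff.2 hr] with u hu
    refine propext ⟨fun h i => ?_, fun h j => h (e j)⟩
    rw [hu i]
    exact h (r i)
  one := by simp [Copula.M_cdf (k := 0), half]

theorem isMarginal_phi : IsMarginal fun k C => bracket C (Copula.M k) where
  le_select k n C e := by
    simpa only [Copula.M_select] using bracket_le_bracket_select C (Copula.M k) e
  select_eq k n C e h := by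
    simpa only [Copula.M_select] using
      bracket_select_eq C (Copula.M k) e h fun i j _ => Copula.M_ae_eq i (e j)
  one := bracket_M_one

theorem isMarginal_tau : IsMarginal fun _ C => bracket C C where
  le_select _ _ C e := bracket_le_bracket_select C C e
  select_eq _ _ C e h := bracket_select_eq C C e h fun _ _ => id
  one := bracket_M_one

section BetaPhiTau

variable {Ω : Type*} [MeasurableSpace Ω] {μ : Measure Ω} [IsProbabilityMeasure μ]

theorem dBeta_eq_family :
    dBeta μ = family μ (fun _ => 1 / 2) fun _ C => C.cdf fun _ => half := rfl

theorem dPhi_eq_family :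
    dPhi μ = family μ (fun _ => 1 / 2) fun k C => bracket C (Copula.M k) := rfl

theorem dTau_eq_family : dTau μ = family μ (fun _ => 1 / 2) fun _ C => bracket C C := rfl

theorem L1_dBeta (m : ℕ) : L1 m (dBeta μ) := by
  rw [dBeta_eq_family]
  exact L1_family m fun _ _ _ h => h _

theorem L1_dPhi (m : ℕ) : L1 m (dPhi μ) := by
  rw [dPhi_eq_family]
  exact L1_family m fun _ _ _ h => bracket_mono_left _ h

theorem L3_dBeta (m : ℕ) : L3 m (dBeta μ) := by
  rw [dBeta_eq_family]
  exact L3_family m fun _ _ _ h => tendsto_cdf h _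

theorem L3_dPhi (m : ℕ) : L3 m (dPhi μ) := by
  rw [dPhi_eq_family]
  exact L3_family m fun _ _ _ h => tendsto_bracket h tendsto_const_nhds

theorem L3_dTau (m : ℕ) : L3 m (dTau μ) := by
  rw [dTau_eq_family]
  exact L3_family m fun _ _ _ h => tendsto_bracket h h

theorem L1c_dTau (m : ℕ) : L1c m (dTau μ) := by
  intro m₁ m₂ _ _ _ X X' Y Y' h
  refine sub_le_sub_left ((bracket_mono_left _ fun u => ?_).trans
    (bracket_mono_right _ fun u => ?_)) _
  · rw [L0.copula_cdf, L0.copula_cdf]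
    exact h.1 u
  · rw [L0.copula_survival, L0.copula_survival]
    exact h.2 u

/-- For independent copies `Z`, `Z'`, the events `1 - Z ≤ 1 - Z'` and `Z' ≤ Z` agree, and
exchanging the copies gives the event `Z ≤ Z'`. -/
theorem L2_dTau (m : ℕ) : L2 m (dTau μ) := by
  intro m₁ m₂ _ _ _ X Y
  have hσ : Measurable fun (u : Fin (m₁ + m₂) → I) i => σ (u i) := by fun_prop
  have hQ : (X.reflect.append Y.reflect).copula.Q
      = (X.append Y).copula.Q.map fun u i => σ (u i) := by
    rw [L0.copula_Q, L0.copula_Q, Measure.map_map hσ (L0.measurable_toFun _)]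
    congr 1
    funext ω i
    refine Fin.addCases (fun i => ?_) (fun j => ?_) i <;>
      simp [L0.append, L0.reflect, L0.toFun]
  refine congrArg (1 / 2 - ·) ?_
  rw [bracket_eq_prod, bracket_eq_prod, hQ, Measure.map_prod_map _ _ hσ hσ,
    map_measureReal_apply (by fun_prop) measurableSet_le']
  nth_rw 1 [← Measure.prod_swap]
  rw [map_measureReal_apply measurable_swap measurableSet_le']
  congr 1
  ext p
  simp [Pi.le_def]

end BetaPhiTau

/-! ### Spearman's rho -/

theorem bracket_Pi_select {k n : ℕ} (C : Copula k) (e : Fin n → Fin k) :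
    bracket (C.select e) (Copula.Pi n) = ∫ u, ∏ j, (1 - (u (e j) : ℝ)) ∂C.Q := by
  rw [bracket_Pi_right, Copula.select, integral_map (Measurable.aemeasurable (by fun_prop))
    (Measurable.aestronglyMeasurable (by fun_prop))]

theorem bracket_Pi_select_equiv {k n : ℕ} (C : Copula k) (e : Fin n ≃ Fin k) :
    bracket (C.select e) (Copula.Pi n) = bracket C (Copula.Pi k) := by
  rw [bracket_Pi_select, bracket_Pi_right]
  exact integral_congr_ae (ae_of_all _ fun u => e.prod_comp fun i => 1 - (u i : ℝ))

theorem dRho_eq_family {Ω : Type*} [MeasurableSpace Ω] (μ : Measure Ω) [IsProbabilityMeasure μ] :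
    dRho μ = family μ (fun k => 1 / ((k : ℝ) + 1)) fun k C => bracket C (Copula.Pi k) := by
  funext m₁ m₂ X Y
  rw [dRho, family, Nat.cast_add]

/-- The map `x ↦ |1 - 2x|` of the unit interval. -/
def absMap (x : I) : I :=
  ⟨|1 - 2 * (x : ℝ)|, abs_nonneg _, abs_le.2 ⟨by linarith [x.2.2], by linarith [x.2.1]⟩⟩

theorem measurePreserving_absMap : MeasurePreserving absMap volume volume := by
  have hm : Measurable absMap := Measurable.subtype_mk (by fun_prop)
  refine ⟨hm, ?_⟩
  have := Measure.isProbabilityMeasure_map (μ := (volume : Measure I)) hm.aemeasurable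
  refine Measure.ext_of_Iic _ _ fun t => ?_
  have ht := t.2
  have hset : absMap ⁻¹' Set.Iic t = Set.Icc ⟨(1 - t) / 2, by constructor <;> linarith [ht.1, ht.2]⟩
      ⟨(1 + t) / 2, by constructor <;> linarith [ht.1, ht.2]⟩ := by
    ext x
    simp only [Set.mem_preimage, Set.mem_Iic, Set.mem_Icc, ← Subtype.coe_le_coe, absMap, abs_le]
    constructor <;> rintro ⟨h, h'⟩ <;> constructor <;> linarith
  rw [Measure.map_apply hm measurableSet_Iic, hset, unitInterval.volume_Icc,
    unitInterval.volume_Iic]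
  congr 1
  ring

theorem measurable_tentVector : Measurable fun x : I => ![x, x, σ (absMap x)] := by
  have := measurePreserving_absMap.measurable
  refine measurable_pi_lambda _ fun i => ?_
  fin_cases i <;> simp <;> fun_prop

/-- The copula of `(U, U, 1 - |1 - 2U|)` with `U` uniform on the unit interval. -/
noncomputable def tentCopula : Copula 3 where
  Q := (volume : Measure I).map fun x => ![x, x, σ (absMap x)]
  isProb := Measure.isProbabilityMeasure_map measurable_tentVector.aemeasurable
  margin := by
    intro i
    rw [Measure.map_map (by fun_prop) measurable_tentVector]
    fin_cases i
    · exact Measure.map_id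
    · exact Measure.map_id
    · exact (unitInterval.measurePreserving_symm.comp measurePreserving_absMap).map_eq

/-- The mixture of the tent copula and the independence copula, with weights `3/4` and `1/4`.
Any weight of the independence copula strictly between `0` and `1/3` refutes reducibility: a weight
`t` gives the dissimilarities `t / 12` and `1 / 12` for pairs, and `(1 + t) / 16` for the triple. -/
noncomputable def mixCopula : Copula 3 where
  Q := (3 / 4 : NNReal) • tentCopula.Q + (1 / 4 : NNReal) • (Copula.Pi 3).Q
  isProb := ⟨by
    simp only [Measure.add_apply, Measure.smul_apply, measure_univ]
    rw [← add_smul]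
    norm_num⟩
  margin i := by
    rw [Measure.map_add _ _ (by fun_prop), Measure.map_smul, Measure.map_smul,
      tentCopula.margin, (Copula.Pi 3).margin, ← add_smul]
    norm_num

theorem tentCopula_select_01 : tentCopula.select ![0, 1] = Copula.M 2 := by
  refine Copula.ext_Q ?_
  change Measure.map _ (Measure.map _ _) = Measure.map _ _
  rw [Measure.map_map (by fun_prop) measurable_tentVector]
  congr 1
  funext x j
  fin_cases j <;> rfl

theorem integral_tentCopula {f : (Fin 3 → I) → ℝ} (hf : Continuous f) :
    ∫ u, f u ∂tentCopula.Q = ∫ x : I, f ![x, x, σ (absMap x)] :=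
  integral_map measurable_tentVector.aemeasurable hf.aestronglyMeasurable

theorem integral_mixCopula {f : (Fin 3 → I) → ℝ} (hf : Continuous f) :
    ∫ u, f u ∂mixCopula.Q
      = 3 / 4 * ∫ u, f u ∂tentCopula.Q + 1 / 4 * ∫ u, f u ∂(Copula.Pi 3).Q := by
  have hint (ν : Measure (Fin 3 → I)) [IsFiniteMeasure ν] : Integrable f ν :=
    hf.integrable_of_hasCompactSupport (HasCompactSupport.of_compactSpace f)
  rw [mixCopula, integral_add_measure (hint _) (hint _), integral_smul_nnreal_measure,
    integral_smul_nnreal_measure]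
  simp [NNReal.smul_def]

theorem bracket_mixCopula_select {n : ℕ} {e : Fin n → Fin 3} (he : Function.Injective e) :
    bracket (mixCopula.select e) (Copula.Pi n)
      = 3 / 4 * bracket (tentCopula.select e) (Copula.Pi n) + 1 / 4 * (1 / 2) ^ n := by
  rw [bracket_Pi_select, bracket_Pi_select, integral_mixCopula (by fun_prop), ← bracket_Pi_select,
    ← bracket_Pi_select, Copula.Pi_select he, bracket_Pi_Pi]

theorem bracket_tentCopula_select {n : ℕ} (e : Fin n → Fin 3) :
    bracket (tentCopula.select e) (Copula.Pi n)
      = ∫ x : I, ∏ j, ![1 - (x : ℝ), 1 - (x : ℝ), |1 - 2 * (x : ℝ)|] (e j) := by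
  rw [bracket_Pi_select, integral_tentCopula (by fun_prop)]
  refine integral_congr_ae (ae_of_all _ fun x => Finset.prod_congr rfl fun j _ => ?_)
  generalize e j = i
  fin_cases i <;> simp [absMap]

theorem integral_abs_one_sub_two_mul {f : ℝ → ℝ} (hf : Continuous f) :
    ∫ x in (0 : ℝ)..1, f x * |1 - 2 * x|
      = (∫ x in (0 : ℝ)..(1 / 2), f x * (1 - 2 * x))
        + ∫ x in (1 / 2 : ℝ)..1, f x * (2 * x - 1) := by
  rw [← intervalIntegral.integral_add_adjacent_intervals (b := 1 / 2)
    (Continuous.intervalIntegrable (by fun_prop) _ _)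
    (Continuous.intervalIntegrable (by fun_prop) _ _)]
  congr 1
  · refine intervalIntegral.integral_congr fun x hx => ?_
    rw [Set.uIcc_of_le (by norm_num)] at hx
    simp only [abs_of_nonneg (show 0 ≤ 1 - 2 * x by linarith [hx.2])]
  · refine intervalIntegral.integral_congr fun x hx => ?_
    rw [Set.uIcc_of_le (by norm_num)] at hx
    simp only [abs_of_nonpos (show 1 - 2 * x ≤ 0 by linarith [hx.1]), neg_sub]

theorem bracket_tent_01 : bracket (tentCopula.select ![0, 1]) (Copula.Pi 2) = 1 / 3 := by
  rw [tentCopula_select_01, bracket_M_Pi]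
  norm_num

theorem integral_tent_pair : ∫ x : I, (1 - (x : ℝ)) * |1 - 2 * (x : ℝ)| = 1 / 4 := by
  rw [integral_unitInterval_eq fun x => (1 - x) * |1 - 2 * x|,
    integral_abs_one_sub_two_mul (by fun_prop)]
  -- The linear term is written as a power so that `integral_pow` applies to it.
  have h1 (x : ℝ) : (1 - x) * (1 - 2 * x) = 1 - 3 * x ^ 1 + 2 * x ^ 2 := by ring
  have h2 (x : ℝ) : (1 - x) * (2 * x - 1) = 3 * x ^ 1 - 1 - 2 * x ^ 2 := by ring
  simp_rw [h1, h2]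
  rw [intervalIntegral.integral_add, intervalIntegral.integral_sub, intervalIntegral.integral_sub,
    intervalIntegral.integral_sub]
  · simp only [intervalIntegral.integral_const_mul, integral_pow,
      intervalIntegral.integral_const]
    norm_num
  all_goals exact Continuous.intervalIntegrable (by fun_prop) _ _

theorem bracket_tent_02 : bracket (tentCopula.select ![0, 2]) (Copula.Pi 2) = 1 / 4 := by
  rw [bracket_tentCopula_select, ← integral_tent_pair]
  simp [Fin.prod_univ_two]

theorem bracket_tent_12 : bracket (tentCopula.select ![1, 2]) (Copula.Pi 2) = 1 / 4 := by
  rw [bracket_tentCopula_select, ← integral_tent_pair]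
  simp [Fin.prod_univ_two]

theorem bracket_tent : bracket (tentCopula.select id) (Copula.Pi 3) = 3 / 16 := by
  rw [bracket_tentCopula_select]
  simp only [Fin.prod_univ_three, id]
  change ∫ x : I, (1 - (x : ℝ)) * (1 - (x : ℝ)) * |1 - 2 * (x : ℝ)| = 3 / 16
  rw [integral_unitInterval_eq fun x => (1 - x) * (1 - x) * |1 - 2 * x|,
    integral_abs_one_sub_two_mul (by fun_prop)]
  have h1 (x : ℝ) : (1 - x) * (1 - x) * (1 - 2 * x) = 1 - 4 * x ^ 1 + 5 * x ^ 2 - 2 * x ^ 3 := by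
    ring
  have h2 (x : ℝ) : (1 - x) * (1 - x) * (2 * x - 1) = 4 * x ^ 1 - 1 - 5 * x ^ 2 + 2 * x ^ 3 := by
    ring
  simp_rw [h1, h2]
  rw [intervalIntegral.integral_add, intervalIntegral.integral_sub, intervalIntegral.integral_sub,
    intervalIntegral.integral_sub, intervalIntegral.integral_add, intervalIntegral.integral_sub]
  · simp only [intervalIntegral.integral_const_mul, integral_pow,
      intervalIntegral.integral_const]
    norm_num
  all_goals exact Continuous.intervalIntegrable (by fun_prop) _ _

theorem Copula.select_id {k : ℕ} (C : Copula k) : C.select id = C :=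
  Copula.ext_Q Measure.map_id

section Rho

variable {Ω : Type*} [MeasurableSpace Ω] {μ : Measure Ω} [IsProbabilityMeasure μ]

/-- For the mixture copula, `d(X', X'') = 1/48` and `d(X', Y) = d(X'', Y) = 1/12`, whereas
`d((X', X''), Y) = 5/64 < 1/12`. -/
theorem not_G1_dRho (hU : ∃ U : Ω → I, MeasurePreserving U μ volume) {m : ℕ} (hm : 3 ≤ m) :
    ¬ G1 m (dRho μ) := by
  intro h
  obtain ⟨X', X'', Y, h01, h02, h12, h012⟩ := L0.exists_triple hU mixCopula
  have b01 := bracket_mixCopula_select (e := ![0, 1]) (by decide)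
  have b02 := bracket_mixCopula_select (e := ![0, 2]) (by decide)
  have b12 := bracket_mixCopula_select (e := ![1, 2]) (by decide)
  have b := bracket_mixCopula_select Function.injective_id
  rw [bracket_tent_01, ← h01] at b01
  rw [bracket_tent_02, ← h02] at b02
  rw [bracket_tent_12, ← h12] at b12
  rw [bracket_tent, Copula.select_id, ← h012] at b
  have d01 : dRho μ 1 1 X' X'' = 1 / 48 := by rw [dRho, b01]; norm_num
  have d02 : dRho μ 1 1 X' Y = 1 / 12 := by rw [dRho, b02]; norm_num
  have d12 : dRho μ 1 1 X'' Y = 1 / 12 := by rw [dRho, b12]; norm_num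
  have d : dRho μ 2 1 (X'.append X'') Y = 5 / 64 := by rw [dRho, b]; norm_num
  have hne (X Y : L0 μ 1) (h0 : dRho μ 1 1 X Y ≠ 0) : (X.append Y).copula ≠ Copula.M 2 := by
    intro hM
    rw [dRho, hM, bracket_M_Pi] at h0
    norm_num at h0
  have := h 1 1 1 le_rfl le_rfl le_rfl hm X' X'' Y
    ⟨L0.disjoint_coords_of_copula_ne (hne _ _ (by rw [d01]; norm_num)),
      L0.disjoint_coords_of_copula_ne (hne _ _ (by rw [d02]; norm_num)),
      L0.disjoint_coords_of_copula_ne (hne _ _ (by rw [d12]; norm_num)),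
      by rw [d01, d02, d12]; norm_num⟩
  rw [d02, d12, d] at this
  norm_num at this

/-- For the tent copula, the first two coordinates agree, but `d((X', X''), Y) = 1/16` and
`d(X', Y) = 1/12`. -/
theorem not_G2_dRho (hU : ∃ U : Ω → I, MeasurePreserving U μ volume) {m : ℕ} (hm : 3 ≤ m) :
    ¬ G2 m (dRho μ) := by
  intro h
  obtain ⟨X', X'', Y, h01, h02, -, h012⟩ := L0.exists_triple hU tentCopula
  have b02 := bracket_tent_02
  have b := bracket_tent
  rw [← h02] at b02
  rw [Copula.select_id, ← h012] at b
  have d02 : dRho μ 1 1 X' Y = 1 / 12 := by rw [dRho, b02]; norm_num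
  have d : dRho μ 2 1 (X'.append X'') Y = 1 / 16 := by rw [dRho, b]; norm_num
  have hcom : (X'.append X'').ComonotonicAt 1 0 := by
    intro u
    rw [L0.select_copula, h01, tentCopula_select_01, Copula.M_select]
  have := h 1 1 le_rfl le_rfl hm (X'.append X'') Y 1 1 ⟨0, by decide, hcom⟩
  have hX : ((X'.append X'').select fun j => (1 : Fin 2).succAbove ((1 : Equiv.Perm (Fin 1)) j))
      = X' := by
    refine Subtype.ext (funext fun i => ?_)
    fin_cases i
    rfl
  rw [hX, d02, d] at this
  norm_num at this

theorem isExtendedDissimilarity_dRho (m : ℕ) : IsExtendedDissimilarity m (dRho μ) := by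
  rw [dRho_eq_family]
  refine isExtendedDissimilarity_family m (fun k C => ?_) (fun k => bracket_M_Pi)
    fun k n C e => bracket_Pi_select_equiv C e
  rw [← bracket_M_Pi]
  exact bracket_mono_left _ C.cdf_le_M_cdf

theorem L1_dRho (m : ℕ) : L1 m (dRho μ) := by
  rw [dRho_eq_family]
  exact L1_family m fun _ _ _ h => bracket_mono_left _ h

theorem L3_dRho (m : ℕ) : L3 m (dRho μ) := by
  rw [dRho_eq_family]
  exact L3_family m fun _ _ _ h => tendsto_bracket h tendsto_const_nhds

end Rho

end Dissim

open Dissim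

theorem mainTheorem1 {Ω : Type*} [MeasurableSpace Ω] (μ : Measure Ω) [IsProbabilityMeasure μ]
    -- the probability space carries a uniformly distributed random variable
    (hU : ∃ U : Ω → I, MeasurePreserving U μ volume)
    (m : ℕ) (hm : 2 ≤ m) :
    (Dissim.IsExtendedDissimilarity m (Dissim.dBeta μ) ∧
      Dissim.IsExtendedDissimilarity m (Dissim.dPhi μ) ∧
      Dissim.IsExtendedDissimilarity m (Dissim.dTau μ) ∧
      Dissim.IsExtendedDissimilarity m (Dissim.dRho μ)) ∧
    (Dissim.L1 m (Dissim.dBeta μ) ∧ Dissim.L1c m (Dissim.dBeta μ) ∧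
      Dissim.L3 m (Dissim.dBeta μ) ∧ Dissim.G1 m (Dissim.dBeta μ) ∧
      (3 ≤ m → Dissim.G1s m (Dissim.dBeta μ)) ∧ Dissim.G2 m (Dissim.dBeta μ)) ∧
    (Dissim.L1 m (Dissim.dPhi μ) ∧ Dissim.L1c m (Dissim.dPhi μ) ∧
      Dissim.L3 m (Dissim.dPhi μ) ∧ Dissim.G1 m (Dissim.dPhi μ) ∧
      (3 ≤ m → Dissim.G1s m (Dissim.dPhi μ)) ∧ Dissim.G2 m (Dissim.dPhi μ)) ∧
    (Dissim.L1c m (Dissim.dTau μ) ∧ Dissim.L2 m (Dissim.dTau μ) ∧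
      Dissim.L3 m (Dissim.dTau μ) ∧ Dissim.G1 m (Dissim.dTau μ) ∧
      (3 ≤ m → Dissim.G1s m (Dissim.dTau μ)) ∧ Dissim.G2 m (Dissim.dTau μ)) ∧
    (Dissim.L1 m (Dissim.dRho μ) ∧ Dissim.L1c m (Dissim.dRho μ) ∧
      Dissim.L3 m (Dissim.dRho μ) ∧
      (3 ≤ m → ¬ Dissim.G1 m (Dissim.dRho μ) ∧ ¬ Dissim.G1s m (Dissim.dRho μ) ∧
        ¬ Dissim.G2 m (Dissim.dRho μ))) := by
  refine ⟨⟨isMarginal_beta.isExtendedDissimilarity m, isMarginal_phi.isExtendedDissimilarity m,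
    isMarginal_tau.isExtendedDissimilarity m, isExtendedDissimilarity_dRho m⟩,
    ⟨L1_dBeta m, (L1_dBeta m).toL1c, L3_dBeta m, isMarginal_beta.G1 m,
      isMarginal_beta.G1s hU ?_ ?_, isMarginal_beta.G2 m⟩,
    ⟨L1_dPhi m, (L1_dPhi m).toL1c, L3_dPhi m,
      isMarginal_phi.G1 m, isMarginal_phi.G1s hU ?_ ?_, isMarginal_phi.G2 m⟩,
    ⟨L1c_dTau m, L2_dTau m, L3_dTau m,
      isMarginal_tau.G1 m, isMarginal_tau.G1s hU ?_ ?_, isMarginal_tau.G2 m⟩,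
    L1_dRho m, (L1_dRho m).toL1c, L3_dRho m, fun h3 =>
      ⟨not_G1_dRho hU h3, fun h => not_G1_dRho hU h3 h.1,
      not_G2_dRho hU h3⟩⟩
  · norm_num [Copula.Pi_cdf, half]
  · norm_num [Copula.Pi_cdf, half]
  · norm_num [bracket_Pi_M]
  · norm_num [bracket_Pi_M]
  · norm_num [bracket_Pi_Pi]
  · norm_num [bracket_Pi_Pi]
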